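/- Let $p=2$ and let the tame level be $N=1$. For an integer $k$ let $d_k=\dim S_k(\mathrm{SL}_2(\mathbb Z))$ and let $d_k^{\mathrm{new}}=\dim S_k(\Gamma_0(2))^{2\text{-new}}$, where the $2$-new subspace is the orthogonal complement, for the Petersson product, of the span of the forms $g(\tau)$ and $g(2\tau)$ with $g\in S_k(\mathrm{SL}_2(\mathbb Z))$. For an integer $\ell\ge 0$ put $s_i(\ell)=i$ if $1\le i\le\lfloor \ell/2\rfloor$, $s_i(\ell)=\ell+1-i$ if $\lfloor \ell/2\rfloor<i\le \ell$, and $s_i(\ell)=0$ for all other integers $i$; put $m_i(k)=s_{i-d_k}(\max(d_k^{\mathrm{new}}-1,0))$. Fix a topological generator $\gamma$ of $1+4\mathbb Z_2$ and write $w_k=\gamma^k-1$. For each $i\geq 0$ there are only finitely many even $k$ with $m_i(k)\neq 0$; the $2$-adic ghost series of tame level $1$ is $$G(w,t)=1+\sum_{i\ge 1}g_i(w)t^i,\qquad g_i(w)=\prod_{k\ \mathrm{even}}(w-w_k)^{m_i(k)}\in\mathbb Z_2[w],$$ and $G_k(t)=G(w_k,t)$. **Theorem.** If $k\le 0$ is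 an even integer and $i\ge 1$, then $g_i(w_k)\ne 0$ and $$v_2(g_i(w_k))=v_2\left(\prod_{j=1}^i 2^{2j}\,\frac{(-k+12j+2)!\,(-k+6j)!}{(-k+8j+2)!\,(-k+8j-2)!\,(-k+12j)}\right).$$ Consequently, for every even $k\le 0$, $G_k(t)$ and the series $$1+\sum_{i\ge1}t^i\prod_{j=1}^i 2^{2j}\,\frac{(-k+12j+2)!\,(-k+6j)!}{(-k+8j+2)!\,(-k+8j-2)!\,(-k+12j)}\in\mathbb Q_2[[t]]$$ have the same $2$-adic Newton polygon (the lower convex hull of the points $(i,v_2(a_i))$ with $a_i\ne0$), and in particular the same sequence of slopes; the slopes of the latter are those predicted by Conjecture 2 of Buzzard and Calegari in "Slopes of overconvergent 2-adic modular forms". -/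

import Mathlib

open scoped MatrixGroups Modular

noncomputable section

namespace Ghost

/-! ### Cusp forms of levels one and two -/

/-- `S_k(SL₂(ℤ)) = S_k(Γ₀(1))`. -/
abbrev LevelOne (k : ℤ) : Type := CuspForm 𝒮ℒ k

/-- `S_k(Γ₀(2))`. -/
abbrev LevelTwo (k : ℤ) : Type :=
  CuspForm ((CongruenceSubgroup.Gamma0 2).map (Matrix.SpecialLinearGroup.mapGL ℝ)) k

/-- The point `2τ` of the upper half plane. -/
def double (τ : UpperHalfPlane) : UpperHalfPlane :=
  (⟨2, two_pos⟩ : {x : ℝ // 0 < x}) • τ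

/-- The `2`-old subspace of `S_k(Γ₀(2))`, spanned by the forms `g(τ)` and `g(2τ)` with
`g ∈ S_k(SL₂(ℤ))`. -/
def oldSubspace (k : ℤ) : Submodule ℂ (LevelTwo k) :=
  Submodule.span ℂ {f | ∃ g : LevelOne k, (∀ τ, f τ = g τ) ∨ (∀ τ, f τ = g (double τ))}

/-- A fundamental domain for `Γ₀(2)`: the union of the translates of the standard fundamental
domain `𝒟` of `SL₂(ℤ)` by the representatives `1, S, ST` of the cosets `Γ₀(2) \ SL₂(ℤ)`. -/
def fundDomain : Set UpperHalfPlane :=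
  {τ | ∃ γ ∈ ({1, ModularGroup.S, ModularGroup.S * ModularGroup.T} : Set SL(2, ℤ)),
    ∃ σ ∈ 𝒟, τ = γ • σ}

/-- The Petersson scalar product `∫ conj(f) g y^k dx dy / y²` over `Γ₀(2) \ ℍ`
(`volume` on the upper half plane is the invariant measure `dx dy / y²`). -/
def peterssonProduct (k : ℤ) (f g : LevelTwo k) : ℂ :=
  ∫ τ in fundDomain, UpperHalfPlane.petersson k f g τ

/-- The `2`-new subspace of `S_k(Γ₀(2))`: the orthogonal complement of the `2`-old subspace for the
Petersson product. (The orthogonal complement is a subspace, so that taking the span does not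
enlarge it.) -/
def newSubspace (k : ℤ) : Submodule ℂ (LevelTwo k) :=
  Submodule.span ℂ {f | ∀ g ∈ oldSubspace k, peterssonProduct k g f = 0}

/-- `d_k = dim S_k(SL₂(ℤ))`. -/
def dimOne (k : ℤ) : ℕ := Module.finrank ℂ (LevelOne k)

/-- `d_k^new = dim S_k(Γ₀(2))^{2-new}`. -/
def dimNew (k : ℤ) : ℕ := Module.finrank ℂ (newSubspace k)

/-! ### The ghost series -/

/-- The terms `s_i(ℓ)`: the sequence `1, 2, 3, …, 3, 2, 1` of length `ℓ`, indexed by `1 ≤ i ≤ ℓ`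
and extended by zero. -/
def pattern (l i : ℕ) : ℕ :=
  if 1 ≤ i ∧ i ≤ l / 2 then i
  else if l / 2 < i ∧ i ≤ l then l + 1 - i
  else 0

/-- The `i`-th term (`i ≥ 1`) of `s(ℓ, d)`, the sequence `s(ℓ)` preceded by `d` zeros and followed
by zeros. -/
def shiftedPattern (l d i : ℕ) : ℕ := if d < i then pattern l (i - d) else 0

/-- The multiplicity `m_i(k)`, i.e. the `i`-th term of `s(d_k^new - 1, d_k)`. When `d_k^new = 0` the
sequence `s(d_k^new - 1)` is empty, which agrees with the truncated subtraction. -/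
def mult (i : ℕ) (k : ℤ) : ℕ := shiftedPattern (dimNew k - 1) (dimOne k) i

/-- `γ` is a topological generator of `1 + 4ℤ₂`. -/
def IsTopGenerator (γ : ℤ_[2]ˣ) : Prop :=
  ((Subgroup.zpowers γ).topologicalClosure : Set ℤ_[2]ˣ) =
    {u : ℤ_[2]ˣ | ∃ x : ℤ_[2], (u : ℤ_[2]) = 1 + 4 * x}

/-- The coordinate `w_k = γ^k - 1` of the weight `z ↦ z^k`. -/
def weightCoord (γ : ℤ_[2]ˣ) (k : ℤ) : ℤ_[2] := ((γ ^ k : ℤ_[2]ˣ) : ℤ_[2]) - 1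

/-- The coefficient `g_i(w) = ∏_{k even} (w - w_k)^{m_i(k)}`. The weight space for `p = 2` has a
single component, whose integral weights are the even integers. -/
def ghostCoeff (γ : ℤ_[2]ˣ) (i : ℕ) : Polynomial ℤ_[2] :=
  ∏ᶠ k : {k : ℤ // Even k}, (Polynomial.X - Polynomial.C (weightCoord γ k)) ^ mult i k

/-- The ghost series `G(w,t) = 1 + ∑_{i ≥ 1} g_i(w) t^i`. -/
def ghostSeries (γ : ℤ_[2]ˣ) : PowerSeries (Polynomial ℤ_[2]) :=
  1 + PowerSeries.mk fun i => if i = 0 then 0 else ghostCoeff γ i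

/-- The specialization `G_k(t) = G(w_k, t)`, with coefficients viewed in `ℚ₂`. -/
def ghostAt (γ : ℤ_[2]ˣ) (k : ℤ) : PowerSeries ℚ_[2] :=
  PowerSeries.map
    ((algebraMap ℤ_[2] ℚ_[2]).comp (Polynomial.evalRingHom (weightCoord γ k))) (ghostSeries γ)

/-! ### Newton polygons -/

/-- The points `(i, v₂(a_i))` with `a_i ≠ 0`. -/
def newtonPoints (P : PowerSeries ℚ_[2]) : Set (ℝ × ℝ) :=
  {z | ∃ i : ℕ, PowerSeries.coeff i P ≠ 0 ∧
    z = ((i : ℝ), ((PowerSeries.coeff i P).valuation : ℝ))}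

/-- The Newton polygon of `P`, as the function whose graph is the lower boundary of the convex hull
of the points `(i, v₂(a_i))` with `a_i ≠ 0`; it is `⊤` off the projection of the hull. -/
def newtonPolygon (P : PowerSeries ℚ_[2]) (x : ℝ) : EReal :=
  ⨅ (y : ℝ) (_ : (x, y) ∈ convexHull ℝ (newtonPoints P)), (y : EReal)

/-- The `n`-th slope (`n ≥ 1`) of the Newton polygon, slopes being listed in increasing order
and repeated according to horizontal length: the slope over the segment `[n - 1, n]`
(the vertices of the polygon have integral abscissae). -/
def newtonSlope (P : PowerSeries ℚ_[2]) (n : ℕ) : ℝ :=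
  (newtonPolygon P n).toReal - (newtonPolygon P ((n : ℝ) - 1)).toReal

/-! ### The Buzzard–Calegari series -/

/-- For `n = -k ≥ 0`, the rational number
`∏_{j=1}^i 2^{2j} (n+12j+2)! (n+6j)! / ((n+8j+2)! (n+8j-2)! (n+12j))`. -/
def bcProduct (n i : ℕ) : ℚ :=
  ∏ j ∈ Finset.Icc 1 i,
    (2 : ℚ) ^ (2 * j) * ((n + 12 * j + 2).factorial : ℚ) * ((n + 6 * j).factorial : ℚ) /
      (((n + 8 * j + 2).factorial : ℚ) * ((n + 8 * j - 2).factorial : ℚ) * ((n + 12 * j : ℕ) : ℚ))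

/-- The power series `1 + ∑_{i ≥ 1} t^i ∏_{j=1}^i 2^{2j} (…)! (…)! / (…)` in weight `k = -n` whose
Newton polygon has the slopes predicted by Buzzard and Calegari. -/
def bcSeries (n : ℕ) : PowerSeries ℚ_[2] :=
  1 + PowerSeries.mk fun i => if i = 0 then 0 else ((bcProduct n i : ℚ) : ℚ_[2])

end Ghost

end

/-! ### Upper bound for the dimension of `S_k(Γ₀(2))` by the norm to level one -/

noncomputable section

open UpperHalfPlane Filter Asymptotics CongruenceSubgroup ModularForm ModularGroup
open scoped MatrixGroups Modular Topology Manifold Real ModularForm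

namespace Ghost

/-! The valuation identity is obtained by differencing in `i`. A topological generator of `1 + 4ℤ₂`
satisfies `v₂(γ^n - 1) = 2 + v₂(n)`, so for `k = -2N` the factor of weight `2m` has valuation `3 +
v₂(m + N)`, and `v₂(g_i(w_k))` is the sum over `m` of `m_i(2m) (3 + v₂(m + N))`. Only positive
weights have nonzero multiplicity, so no factor vanishes at `k ≤ 0`.

For a fixed weight the multiplicities form a tent in `i`, with steps `+1`, `0`, `-1`. Read for fixed
`j`, the dimension formulas turn `m_j(2m) - m_{j-1}(2m)` into `+1` for `4j+1 < m ≤ 6j+1`, `m ≠ 6j`,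
and `-1` for `3j < m ≤ 4j-1` (`mult_sub`). Sums of `v₂(m + N)` over intervals are valuations of
quotients of factorials, and the result is the valuation of the `j`-th Buzzard–Calegari factor
(`padicValRat_bcFactor`); `sum_mult_eq` adds these up. The Newton polygons agree because all their
defining points do.

The dimensions come from three facts. The product of the three translates of a form on `Γ₀(2)` is a
level one form of weight `3k`, which bounds `dim S_k(Γ₀(2))` above; explicit products of Eisenstein
series attain the bound (`finrank_levelTwo`). The old space is a direct sum of two copies of
`S_k(SL₂(ℤ))` (`oldMap_injective`). The Petersson product is positive definite, so the new space is
a complement (`dimNew_add`). -/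

/-- A level one form of weight `k` vanishing to order `m > k / 12` at infinity is zero. -/
lemma eq_zero_of_isBigO_exp {k : ℤ} {m : ℕ} {F : ℍ → ℂ} (hF : MDiff F) (hS : F ∣[k] S = F)
    (hT : F ∣[k] T = F) (hO : F =O[atImInfty] fun τ ↦ Real.exp (-2 * π * τ.im) ^ m)
    (hk : k < 12 * m) : F = 0 := by
  have hinv := SlashInvariantForm.slash_action_generators_SL2Z hS hT
  let D : ModularForm 𝒮ℒ (m * 12) := ModularForm.pow (CuspForm.discriminant : ModularForm 𝒮ℒ 12) m
  have hD : (D : ℍ → ℂ) = ModularForm.discriminant ^ m := by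
    simp only [D, ModularForm.coe_pow]; rfl
  have hD0 (τ : ℍ) : D τ ≠ 0 := by
    rw [hD]; exact pow_ne_zero _ (ModularForm.discriminant_ne_zero τ)
  have hslash (γ : SL(2, ℤ)) : (F / ⇑D) ∣[k - m * 12] γ = F / ⇑D := by
    rw [div_slash_SL2, hinv γ]
    congr 1
    exact SlashInvariantFormClass.slash_action_eq D _ ⟨γ, rfl⟩
  let G : ModularForm 𝒮ℒ (k - m * 12) :=
    { toFun := F / ⇑D
      slash_action_eq' := by rintro _ ⟨γ, rfl⟩; exact hslash γ
      holo' := hF.div D.holo' hD0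
      bdd_at_cusps' {c} hc := by
        rw [Subgroup.IsArithmetic.isCusp_iff_isCusp_SL2Z] at hc
        rw [OnePoint.isBoundedAt_iff_forall_SL2Z hc]
        intro γ _
        rw [hslash γ, IsBoundedAtImInfty, BoundedAtFilter]
        -- `Δ` has a simple zero at infinity, so `exp(-2πy)^m` is dominated by `Δ^m`.
        refine (div_isBoundedUnder_of_isBigO (hO.trans ?_)).isBigO_one ℝ
        rw [hD]
        exact exp_isBigO_discriminant.pow m }
  have hG : ⇑G = 0 := ModularFormClass.levelOne_neg_weight_eq_zero (by lia) G
  ext τ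
  have := congrFun hG τ
  change F τ / D τ = 0 at this
  simpa [hD0 τ] using this

section GammaZeroTwo

variable {k : ℤ} {f : ℍ → ℂ}

lemma slash_eq_slash_of_mem (hf : ∀ γ ∈ Gamma0 2, f ∣[k] γ = f) {γ δ : SL(2, ℤ)}
    (h : γ * δ⁻¹ ∈ Gamma0 2) : f ∣[k] γ = f ∣[k] δ := by
  have := hf _ h
  conv_rhs => rw [← this, ← SlashAction.slash_mul]
  simp

lemma T_mem_Gamma0_two : T ∈ Gamma0 2 := Gamma0_mem.mpr (by decide)

/-- The product of the translates of a form on `Γ₀(2)` by the cosets of `Γ₀(2)` in `SL₂(ℤ)`. -/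
def cosetProd (k : ℤ) (f : ℍ → ℂ) : ℍ → ℂ := f * (f ∣[k] S) * (f ∣[k] (S * T))

/-- Right multiplication by `S` exchanges the cosets of `1` and `S` and fixes that of `ST`. -/
lemma cosetProd_slash_S (hf : ∀ γ ∈ Gamma0 2, f ∣[k] γ = f) :
    cosetProd k f ∣[k + k + k] S = cosetProd k f := by
  rw [cosetProd, mul_slash_SL2, mul_slash_SL2, ← SlashAction.slash_mul, ← SlashAction.slash_mul,
    slash_eq_slash_of_mem (δ := 1) hf (γ := S * S) (Gamma0_mem.mpr (by decide)),
    slash_eq_slash_of_mem (δ := S * T) hf (γ := S * T * S) (Gamma0_mem.mpr (by decide)), SlashAction.slash_one,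
    mul_comm (f ∣[k] S)]

/-- Right multiplication by `T` fixes the trivial coset and exchanges those of `S` and `ST`. -/
lemma cosetProd_slash_T (hf : ∀ γ ∈ Gamma0 2, f ∣[k] γ = f) :
    cosetProd k f ∣[k + k + k] T = cosetProd k f := by
  rw [cosetProd, mul_slash_SL2, mul_slash_SL2, ← SlashAction.slash_mul, ← SlashAction.slash_mul,
    slash_eq_slash_of_mem (δ := S) hf (γ := S * T * T) (Gamma0_mem.mpr (by decide)), hf T T_mem_Gamma0_two]
  ring

lemma eq_zero_of_cosetProd_eq_zero (hf : MDiff f) (h : cosetProd k f = 0) : f = 0 := by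
  have hSL (γ : SL(2, ℤ)) : MDiff (f ∣[k] γ) := hf.slash k _
  rw [cosetProd, UpperHalfPlane.mul_eq_zero_iff (hf.mul (hSL S)) (hSL _),
    UpperHalfPlane.mul_eq_zero_iff hf (hSL S), SlashAction.slash_eq_zero_iff,
    SlashAction.slash_eq_zero_iff] at h
  tauto

lemma slash_T_apply (f : ℍ → ℂ) (τ : ℍ) : (f ∣[k] T) τ = f ((1 : ℝ) +ᵥ τ) := by
  rw [SL_slash_apply, modular_T_smul, ModularGroup.denom_apply]
  simp [T]

lemma periodic_of_slash_T_sq (h : f ∣[k] (T * T) = f) : Function.Periodic (f ∘ ofComplex) (2 : ℝ) := by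
  intro w
  by_cases! hw : 0 < w.im
  · have hw' : 0 < (w + (2 : ℝ)).im := by simpa using hw
    simp only [Function.comp_apply, ofComplex_apply_of_im_pos hw', ofComplex_apply_of_im_pos hw]
    conv_rhs => rw [← h, SlashAction.slash_mul, slash_T_apply, slash_T_apply]
    congr 1
    ext
    simp
    ring
  · have : (w + (2 : ℝ)).im ≤ 0 := by simpa using hw
    simp only [Function.comp_apply, ofComplex_apply_of_im_nonpos this, ofComplex_apply_of_im_nonpos hw]

/-- The cusp `0` has width `2`: the translate has period `2`, so its vanishing at infinity only
gives decay like `q^(1/2)`. -/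
lemma isBigO_slash_S (hf : MDiff f) (hinv : ∀ γ ∈ Gamma0 2, f ∣[k] γ = f)
    (h0 : IsZeroAtImInfty (f ∣[k] S)) :
    (f ∣[k] S) =O[atImInfty] fun τ ↦ Real.exp (-2 * π * τ.im / 2) := by
  refine h0.exp_decay_atImInfty two_pos (periodic_of_slash_T_sq (k := k) ?_) (hf.slash k _)
    h0.isBoundedAtImInfty
  rw [← SlashAction.slash_mul, ← mul_assoc]
  exact slash_eq_slash_of_mem hinv (Gamma0_mem.mpr (by decide))

lemma isBigO_slash_S_mul_T (hf : MDiff f) (hinv : ∀ γ ∈ Gamma0 2, f ∣[k] γ = f)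
    (h0 : IsZeroAtImInfty (f ∣[k] S)) :
    (f ∣[k] (S * T)) =O[atImInfty] fun τ ↦ Real.exp (-2 * π * τ.im / 2) := by
  have h1 : Tendsto (fun τ : ℍ ↦ (1 : ℝ) +ᵥ τ) atImInfty atImInfty := by
    rw [atImInfty, tendsto_comap_iff]
    simpa [Function.comp_def] using! tendsto_comap
  have := (isBigO_slash_S hf hinv h0).comp_tendsto h1
  simp only [Function.comp_def, vadd_im] at this
  refine this.congr_left fun τ ↦ ?_
  rw [SlashAction.slash_mul, slash_T_apply]

end GammaZeroTwo

lemma one_mem_strictPeriods_Gamma0_two :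
    (1 : ℝ) ∈ ((Gamma0 2).map (Matrix.SpecialLinearGroup.mapGL ℝ)).strictPeriods := by simp

lemma slash_eq_of_mem_Gamma0 {k : ℤ} {F : Type*} [FunLike F ℍ ℂ]
    [SlashInvariantFormClass F ((Gamma0 2).map (Matrix.SpecialLinearGroup.mapGL ℝ)) k] (f : F) :
    ∀ γ ∈ Gamma0 2, ⇑f ∣[k] γ = f :=
  fun γ hγ ↦ SlashInvariantFormClass.slash_action_eq f _ ⟨γ, hγ, rfl⟩

lemma isBigO_of_qExpansion_coeff_eq_zero {k : ℤ} (f : LevelTwo k) {n : ℕ}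
    (h : ∀ i < n, (qExpansion 1 f).coeff i = 0) :
    f =O[atImInfty] fun τ ↦ Real.exp (-2 * π * τ.im) ^ n := by
  have han := ModularFormClass.analyticAt_cuspFunction_zero f one_pos
    one_mem_strictPeriods_Gamma0_two
  have hp : HasFPowerSeriesAt (cuspFunction 1 f) (qExpansionFormalMultilinearSeries 1 f) 0 :=
    (hasFPowerSeries_cuspFunction f one_pos han
      (ModularForm.hasSum_qExpansion f one_pos one_mem_strictPeriods_Gamma0_two)).hasFPowerSeriesAt
  have h1 := hp.isBigO_sub_partialSum_pow n
  have h2 (y : ℂ) : (qExpansionFormalMultilinearSeries 1 f).partialSum n y = 0 := by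
    refine Finset.sum_eq_zero fun i hi ↦ ?_
    rw [FormalMultilinearSeries.apply_eq_prod_smul_coeff,
      qExpansionFormalMultilinearSeries_coeff, h i (Finset.mem_range.mp hi), smul_zero]
  simp only [zero_add, h2, sub_zero] at h1
  refine (h1.comp_tendsto (qParam_tendsto_atImInfty one_pos)).congr (fun τ ↦ ?_) fun τ ↦ ?_
  · exact SlashInvariantFormClass.eq_cuspFunction f τ one_mem_strictPeriods_Gamma0_two one_ne_zero
  · simp [Function.Periodic.norm_qParam]

/-- The norm of `f` vanishes to order `n + 1`: `n` from `f` itself and `1/2` from each of the two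
translates at the cusp `0`. Its weight is `3k < 12(n + 1)`, so it is zero. -/
lemma levelTwo_eq_zero {k : ℤ} (f : LevelTwo k) {n : ℕ} (hk : k < 4 * (n + 1))
    (h : ∀ i < n, (qExpansion 1 f).coeff i = 0) : f = 0 := by
  have hinv := slash_eq_of_mem_Gamma0 f
  have hmd : MDiff (f : ℍ → ℂ) := f.holo'
  have h0 : IsZeroAtImInfty (f ∣[k] S) := CuspFormClass.zero_at_infty_slash f S
  have hO : cosetProd k f =O[atImInfty] fun τ ↦ Real.exp (-2 * π * τ.im) ^ (n + 1) := by
    refine (((isBigO_of_qExpansion_coeff_eq_zero f h).mul (isBigO_slash_S hmd hinv h0)).mul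
      (isBigO_slash_S_mul_T hmd hinv h0)).congr_right fun τ ↦ ?_
    rw [pow_succ, mul_assoc, ← Real.exp_add]
    ring_nf
  have := eq_zero_of_isBigO_exp ((hmd.mul (hmd.slash k _)).mul (hmd.slash k _))
    (cosetProd_slash_S hinv) (cosetProd_slash_T hinv) hO (by push_cast; lia)
  exact DFunLike.coe_injective (eq_zero_of_cosetProd_eq_zero hmd this)

/-- The `q`-expansion coefficients `a_1, …, a_n` as a linear map. -/
def coeffMap (k : ℤ) (n : ℕ) : LevelTwo k →ₗ[ℂ] Fin n → ℂ where
  toFun f i := (qExpansion 1 f).coeff (i + 1)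
  map_add' f g := by
    ext i
    simp [ModularForm.qExpansion_add one_pos one_mem_strictPeriods_Gamma0_two f g]
  map_smul' c f := by
    ext i
    simp [ModularForm.qExpansion_smul one_pos one_mem_strictPeriods_Gamma0_two c f]

lemma coeffMap_injective {k : ℤ} {n : ℕ} (hk : k < 4 * (n + 2)) :
    Function.Injective (coeffMap k n) := by
  rw [injective_iff_map_eq_zero]
  intro f hf
  -- The constant coefficient vanishes for a cusp form, so `n` coordinates control `n + 1`
  -- coefficients.
  refine levelTwo_eq_zero f (n := n + 1) (by push_cast; lia) fun i hi ↦ ?_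
  rcases i with _ | i
  · exact CuspFormClass.qExpansion_coeff_zero f one_pos one_mem_strictPeriods_Gamma0_two
  · exact congrFun hf ⟨i, by lia⟩

instance (k : ℤ) : FiniteDimensional ℂ (LevelTwo k) :=
  .of_injective (coeffMap k k.toNat) (coeffMap_injective (by lia))

lemma finrank_levelTwo_le (k : ℤ) : Module.finrank ℂ (LevelTwo k) ≤ k.toNat / 4 - 1 := by
  simpa using LinearMap.finrank_le_finrank_of_injective
    (coeffMap_injective (k := k) (n := k.toNat / 4 - 1) (by lia))

end Ghost
end

/-! ### Forms with prescribed cusp values, lower bound and dimension formulas -/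

noncomputable section

open UpperHalfPlane Filter Asymptotics CongruenceSubgroup ModularForm ModularGroup
open scoped MatrixGroups Modular Topology Manifold Real ModularForm

namespace Ghost

/-- The matrix `diag(2, 1)`. -/
def doubleMatrix : GL (Fin 2) ℝ :=
  Matrix.GeneralLinearGroup.mkOfDetNeZero !![2, 0; 0, 1] (by simp)

lemma det_doubleMatrix : doubleMatrix.det.val = 2 := by
  simp [doubleMatrix, Matrix.GeneralLinearGroup.mkOfDetNeZero]

@[simp]
lemma coe_double (τ : ℍ) : (double τ : ℂ) = 2 * τ := by
  simp [double]

@[simp]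
lemma im_double (τ : ℍ) : (double τ).im = 2 * τ.im := by
  simp [double]

lemma doubleMatrix_smul (τ : ℍ) : doubleMatrix • τ = double τ := by
  ext
  rw [coe_smul_of_det_pos (by rw [det_doubleMatrix]; norm_num)]
  simp [num, denom, doubleMatrix, Matrix.GeneralLinearGroup.mkOfDetNeZero]

lemma tendsto_double : Tendsto double atImInfty atImInfty := by
  rw [atImInfty, tendsto_comap_iff]
  simpa [Function.comp_def] using! tendsto_comap.const_mul_atTop (two_pos (α := ℝ))

/-- The point `τ / 2` of the upper half plane. -/
def halve (τ : ℍ) : ℍ := (⟨2⁻¹, by norm_num⟩ : {x : ℝ // 0 < x}) • τ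

@[simp]
lemma coe_halve (τ : ℍ) : (halve τ : ℂ) = 2⁻¹ * τ := by
  simp [halve]

lemma tendsto_halve : Tendsto halve atImInfty atImInfty := by
  rw [atImInfty, tendsto_comap_iff]
  simpa [Function.comp_def, halve] using! tendsto_comap.const_mul_atTop (by norm_num : (0 : ℝ) < 2⁻¹)

lemma halve_double (τ : ℍ) : halve (double τ) = τ := by ext; simp

lemma mdifferentiable_comp_double {f : ℍ → ℂ} (hf : MDiff f) : MDiff (fun τ ↦ f (double τ)) := by
  have := hf.comp (mdifferentiable_smul (g := doubleMatrix) (by rw [det_doubleMatrix]; norm_num))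
  simpa [Function.comp_def, doubleMatrix_smul] using this

/-- Conjugation by `diag(2, 1)` carries `Γ₀(2)` into `SL₂(ℤ)`: the matrix with rows `(a, b)`, `(2c,
d)` becomes the one with rows `(a, 2b)`, `(c, d)`. -/
lemma comp_double_slash {k : ℤ} {f : ℍ → ℂ} (hf : ∀ γ : SL(2, ℤ), f ∣[k] γ = f) {γ : SL(2, ℤ)}
    (hγ : γ ∈ Gamma0 2) : (fun τ ↦ f (double τ)) ∣[k] γ = fun τ ↦ f (double τ) := by
  obtain ⟨c, hc⟩ := (ZMod.intCast_zmod_eq_zero_iff_dvd _ _).mp (Gamma0_mem.mp hγ)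
  have hdet : γ 0 0 * γ 1 1 - γ 0 1 * γ 1 0 = 1 := by
    rw [← Matrix.det_fin_two]; exact γ.det_coe
  let δ : SL(2, ℤ) := ⟨!![γ 0 0, 2 * γ 0 1; c, γ 1 1], by
    rw [Matrix.det_fin_two_of]; push_cast at hc; linear_combination hdet + γ 0 1 * hc⟩
  have hcC : ((γ 1 0 : ℤ) : ℂ) = 2 * c := by rw [hc]; push_cast; ring
  have hden (τ : ℍ) : denom δ (double τ) = denom γ τ := by
    rw [denom_apply, denom_apply]
    simp only [δ, coe_double, Matrix.of_apply, Matrix.cons_val]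
    rw [hcC]
    ring
  have hsmul (τ : ℍ) : double (γ • τ) = δ • double τ := by
    ext
    have h1 := hden τ
    rw [denom_apply, denom_apply] at h1
    rw [coe_double, coe_specialLinearGroup_apply, coe_specialLinearGroup_apply]
    simp only [algebraMap_int_eq, eq_intCast, Complex.ofReal_intCast]
    rw [h1]
    simp [δ]
    ring
  ext τ
  rw [SL_slash_apply, hsmul, ← hden, ← SL_slash_apply, hf]

/-- This gives the behaviour of `f(2τ)` at the cusp `0`, from `2 · (-1/τ) = -1/(τ/2)`. -/
lemma comp_double_slash_S {k : ℤ} {f : ℍ → ℂ} (hf : f ∣[k] S = f) :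
    (fun τ ↦ f (double τ)) ∣[k] S = fun τ ↦ (2 : ℂ) ^ (-k) * f (halve τ) := by
  ext τ
  have h1 : double (S • τ) = S • halve τ := by
    ext
    rw [coe_double, modular_S_smul, modular_S_smul]
    simp [mul_comm]
  have h2 := congrFun hf (halve τ)
  rw [SL_slash_apply, denom_S] at h2
  rw [SL_slash_apply, h1, denom_S, ← h2, coe_halve, mul_zpow, inv_zpow, zpow_neg 2, inv_inv]
  have : (2 : ℂ) ^ k ≠ 0 := zpow_ne_zero _ two_ne_zero
  field_simp

/-- `f` is a holomorphic form of weight `k` on `Γ₀(2)` with values `a`, `b` at the cusps `∞`, `0`. -/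
structure HasCuspValues (k : ℤ) (f : ℍ → ℂ) (a b : ℂ) : Prop where
  slash_eq : ∀ γ ∈ Gamma0 2, f ∣[k] γ = f
  mdifferentiable : MDiff f
  tendsto : Tendsto f atImInfty (𝓝 a)
  tendsto_slash_S : Tendsto (f ∣[k] S) atImInfty (𝓝 b)

namespace HasCuspValues

variable {k l : ℤ} {f g : ℍ → ℂ} {a b c d : ℂ}

lemma sub (hf : HasCuspValues k f a b) (hg : HasCuspValues k g c d) :
    HasCuspValues k (f - g) (a - c) (b - d) where
  slash_eq γ hγ := by
    rw [sub_eq_add_neg, SlashAction.add_slash, SlashAction.neg_slash, hf.slash_eq γ hγ,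
      hg.slash_eq γ hγ]
  mdifferentiable := hf.mdifferentiable.sub hg.mdifferentiable
  tendsto := hf.tendsto.sub hg.tendsto
  tendsto_slash_S := by
    rw [sub_eq_add_neg, SlashAction.add_slash, SlashAction.neg_slash, ← sub_eq_add_neg]
    exact hf.tendsto_slash_S.sub hg.tendsto_slash_S

lemma const_smul (x : ℂ) (hf : HasCuspValues k f a b) :
    HasCuspValues k (x • f) (x * a) (x * b) where
  slash_eq γ hγ := by rw [SL_smul_slash, hf.slash_eq γ hγ]
  mdifferentiable := hf.mdifferentiable.const_smul x
  tendsto := hf.tendsto.const_mul x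
  tendsto_slash_S := by
    rw [SL_smul_slash]
    exact hf.tendsto_slash_S.const_mul x

lemma mul (hf : HasCuspValues k f a b) (hg : HasCuspValues l g c d) :
    HasCuspValues (k + l) (f * g) (a * c) (b * d) where
  slash_eq γ hγ := by rw [mul_slash_SL2, hf.slash_eq γ hγ, hg.slash_eq γ hγ]
  mdifferentiable := hf.mdifferentiable.mul hg.mdifferentiable
  tendsto := hf.tendsto.mul hg.tendsto
  tendsto_slash_S := by
    rw [mul_slash_SL2]
    exact hf.tendsto_slash_S.mul hg.tendsto_slash_S

lemma one : HasCuspValues 0 1 1 1 where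
  slash_eq γ _ := is_invariant_one γ
  mdifferentiable := mdifferentiable_const
  tendsto := tendsto_const_nhds
  tendsto_slash_S := by
    rw [is_invariant_one]
    exact tendsto_const_nhds

lemma pow (hf : HasCuspValues k f a b) (n : ℕ) : HasCuspValues (n * k) (f ^ n) (a ^ n) (b ^ n) := by
  induction n with
  | zero => simpa using one
  | succ n ih => simpa [pow_succ, add_mul] using! ih.mul hf

lemma ne_zero_of_left (hf : HasCuspValues k f a b) (ha : a ≠ 0) : f ≠ 0 := by
  rintro rfl
  exact ha (tendsto_nhds_unique hf.tendsto tendsto_const_nhds)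

lemma ne_zero_of_right (hf : HasCuspValues k f a b) (hb : b ≠ 0) : f ≠ 0 := by
  rintro rfl
  refine hb (tendsto_nhds_unique hf.tendsto_slash_S ?_)
  rw [SlashAction.zero_slash]
  exact tendsto_const_nhds

/-- A form on `Γ₀(2)` vanishing at the cusps `∞` and `0` is a cusp form. -/
def cuspForm (hf : HasCuspValues k f 0 0) : LevelTwo k where
  toFun := f
  slash_action_eq' := by rintro _ ⟨γ, hγ, rfl⟩; exact hf.slash_eq γ hγ
  holo' := hf.mdifferentiable
  zero_at_cusps' {c} hc := by
    rw [Subgroup.IsArithmetic.isCusp_iff_isCusp_SL2Z] at hc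
    rw [OnePoint.isZeroAt_iff_forall_SL2Z hc]
    intro γ _
    change IsZeroAtImInfty (f ∣[k] γ)
    by_cases hγ : γ ∈ Gamma0 2
    · rw [hf.slash_eq γ hγ]
      exact hf.tendsto
    · have hmem : γ * (S * T ^ (γ 1 1))⁻¹ ∈ Gamma0 2 := by
        rw [Gamma0_mem, mul_inv_rev, ← zpow_neg, show S⁻¹ = -S by decide]
        have : (γ * (T ^ (-γ 1 1) * -S)) 1 0 = γ 1 0 * γ 1 1 - γ 1 1 := by
          rw [Matrix.SpecialLinearGroup.coe_mul, Matrix.SpecialLinearGroup.coe_mul, coe_T_zpow,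
            Matrix.SpecialLinearGroup.coe_neg, S]
          simp [Matrix.mul_apply]
          ring
        rw [this]
        have h1 : ((γ 1 0 : ℤ) : ZMod 2) = 1 := by
          rw [Gamma0_mem] at hγ
          generalize ((γ 1 0 : ℤ) : ZMod 2) = x at *
          revert hγ; revert x; decide
        push_cast
        rw [h1]
        ring
      rw [slash_eq_slash_of_mem hf.slash_eq hmem, SlashAction.slash_mul]
      refine IsZeroAtImInfty.slash k ?_ hf.tendsto_slash_S
      rw [Matrix.SpecialLinearGroup.mapGL_coe_matrix, Matrix.SpecialLinearGroup.map_apply_coe,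
        RingHom.mapMatrix_apply, Matrix.map_apply, coe_T_zpow]
      simp

@[simp]
lemma coe_cuspForm (hf : HasCuspValues k f 0 0) : ⇑hf.cuspForm = f := rfl

end HasCuspValues

lemma slash_eq_levelOne {k : ℤ} {F : Type*} [FunLike F ℍ ℂ] [SlashInvariantFormClass F 𝒮ℒ k]
    (f : F) (γ : SL(2, ℤ)) : ⇑f ∣[k] γ = f :=
  SlashInvariantFormClass.slash_action_eq f _ ⟨γ, rfl⟩

lemma hasCuspValues_levelOne {k : ℤ} {F : Type*} [FunLike F ℍ ℂ] [ModularFormClass F 𝒮ℒ k]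
    {f : F} {a : ℂ} (ha : Tendsto f atImInfty (𝓝 a)) : HasCuspValues k f a a where
  slash_eq γ _ := slash_eq_levelOne f γ
  mdifferentiable := ModularFormClass.holo f
  tendsto := ha
  tendsto_slash_S := by rwa [slash_eq_levelOne]

lemma hasCuspValues_comp_double {k : ℤ} {F : Type*} [FunLike F ℍ ℂ] [ModularFormClass F 𝒮ℒ k]
    {f : F} {a : ℂ} (ha : Tendsto f atImInfty (𝓝 a)) :
    HasCuspValues k (fun τ ↦ f (double τ)) a (2 ^ (-k) * a) where
  slash_eq γ hγ := comp_double_slash (slash_eq_levelOne f) hγ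
  mdifferentiable := mdifferentiable_comp_double (ModularFormClass.holo f)
  tendsto := ha.comp tendsto_double
  tendsto_slash_S := by
    rw [comp_double_slash_S (slash_eq_levelOne f S)]
    exact (ha.comp tendsto_halve).const_mul _

lemma tendsto_E {k : ℕ} (hk : 3 ≤ k) (hk2 : Even k) :
    Tendsto (E hk) atImInfty (𝓝 1) := by
  have h1 : valueAtInfty (E hk) = 1 := by
    rw [← EisensteinSeries.E_qExpansion_coeff_zero hk hk2, qExpansion_coeff_zero one_pos
      (ModularFormClass.analyticAt_cuspFunction_zero _ one_pos one_mem_strictPeriods_SL)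
      (SlashInvariantFormClass.periodic_comp_ofComplex _ one_mem_strictPeriods_SL)]
  have h2 := IsZeroAtImInfty.of_exp_decay (ModularFormClass.exp_decay_sub_atImInfty' (E hk))
  rw [h1] at h2
  simpa using! h2.add_const 1

/-- The form `E_k(τ) - E_k(2τ)`, which vanishes only at the cusp `∞`. -/
lemma hasCuspValues_E_sub {k : ℕ} (hk : 3 ≤ k) (hk2 : Even k) :
    HasCuspValues k (⇑(E hk) - fun τ ↦ E hk (double τ)) 0 (1 - 2 ^ (-k : ℤ)) := by
  simpa using (hasCuspValues_levelOne (tendsto_E hk hk2)).sub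
    (hasCuspValues_comp_double (tendsto_E hk hk2))

/-- The form `2 ^ k E_k(2τ) - E_k(τ)`, which vanishes at the cusp `0`. -/
lemma hasCuspValues_smul_E_sub {k : ℕ} (hk : 3 ≤ k) (hk2 : Even k) :
    HasCuspValues k (((2 : ℂ) ^ k • fun τ ↦ E hk (double τ)) - ⇑(E hk)) (2 ^ k - 1) 0 := by
  simpa using ((hasCuspValues_comp_double (tendsto_E hk hk2)).const_smul (2 ^ k)).sub
    (hasCuspValues_levelOne (tendsto_E hk hk2))

/-- At infinity only the term `j = 0` survives, which forces `c 0 = 0`; dividing by `B`, legitimate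
because holomorphic functions on `ℍ` have no zero divisors, lowers `n`. -/
lemma sum_mul_pow_eq_zero {B C : ℍ → ℂ} (hB : MDiff B) (hB0 : B ≠ 0) (hBt : Tendsto B atImInfty (𝓝 0))
    (hC : MDiff C) {y : ℂ} (hy : y ≠ 0) (hCt : Tendsto C atImInfty (𝓝 y)) {n : ℕ} {c : ℕ → ℂ}
    (h : ∑ j ∈ Finset.range n, c j • (B ^ j * C ^ (n - 1 - j)) = 0) : ∀ j < n, c j = 0 := by
  induction n generalizing c with
  | zero => simp
  | succ n ih =>
    have h0 : c 0 = 0 := by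
      have ht : Tendsto (∑ j ∈ Finset.range (n + 1), c j • (B ^ j * C ^ (n + 1 - 1 - j))) atImInfty
          (𝓝 (∑ j ∈ Finset.range (n + 1), c j * (0 ^ j * y ^ (n - j)))) := by
        rw [Finset.sum_fn]
        exact tendsto_finsetSum _ fun j _ ↦ (((hBt.pow j).mul (hCt.pow (n - j))).const_mul (c j))
      rw [h] at ht
      have := tendsto_nhds_unique ht (tendsto_const_nhds (x := (0 : ℂ)))
      simpa [Finset.sum_range_succ', hy] using this
    have hsum : ∑ j ∈ Finset.range n, c (j + 1) • (B ^ j * C ^ (n - 1 - j)) = 0 := by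
      refine ((UpperHalfPlane.mul_eq_zero_iff hB ?_).mp ?_).resolve_left hB0
      · exact .sum fun j _ ↦ ((hB.pow j).mul (hC.pow _)).const_smul _
      · rw [Finset.sum_range_succ', h0, zero_smul, add_zero] at h
        rw [← h, Finset.mul_sum]
        refine Finset.sum_congr rfl fun j _ ↦ ?_
        rw [show n + 1 - 1 - (j + 1) = n - 1 - j by lia, pow_succ', mul_smul_comm, mul_assoc]
    rintro (_ | j) hj
    · exact h0
    · exact ih hsum j (by lia)

/-- The `n` products `F C B^j C^(n-1-j)` have weight `k₀ + 4 + 4(n-1) = k`. The factor `F` vanishes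
at `∞` and `C` at `0`, so each is a cusp form; they are independent because `B` vanishes at `∞` and
`C` does not. -/
lemma le_finrank_levelTwo {k₀ : ℕ} (hk₀ : 3 ≤ k₀) (hk₀2 : Even k₀) {k : ℤ} {n : ℕ}
    (hk : k = k₀ + 4 * n) : n ≤ Module.finrank ℂ (LevelTwo k) := by
  have hF := hasCuspValues_E_sub hk₀ hk₀2
  have hB := hasCuspValues_E_sub (k := 4) (by norm_num) (by decide)
  have hC := hasCuspValues_smul_E_sub (k := 4) (by norm_num) (by decide)
  set F := ⇑(E hk₀) - fun τ ↦ E hk₀ (double τ)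
  set B := ⇑(E (k := 4) (by norm_num)) - fun τ ↦ E (k := 4) (by norm_num) (double τ)
  set C := ((2 : ℂ) ^ 4 • fun τ ↦ E (k := 4) (by norm_num) (double τ)) - ⇑(E (k := 4) (by norm_num))
  have hΦ (j : Fin n) :
      HasCuspValues k ((F * C) * (B ^ (j : ℕ) * C ^ (n - 1 - (j : ℕ)))) 0 0 := by
    have hw : k = (k₀ + (4 : ℕ)) + ((j : ℕ) * (4 : ℕ) + (n - 1 - (j : ℕ) : ℕ) * (4 : ℕ)) := by
      have := j.2
      lia
    rw [hw]
    simpa using (hF.mul hC).mul ((hB.pow j).mul (hC.pow (n - 1 - j)))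
  have hone : (1 : ℂ) - 2 ^ (-k₀ : ℤ) ≠ 0 := by
    rw [sub_ne_zero, zpow_neg, zpow_natCast]
    intro h
    have : (2 : ℂ) ^ k₀ = 1 := by rw [← inv_inv ((2 : ℂ) ^ k₀), ← h, inv_one]
    have : (2 : ℕ) ^ k₀ = 1 := mod_cast this
    exact absurd this (Nat.one_lt_two_pow (by lia)).ne'
  have hli : LinearIndependent ℂ fun j ↦ (hΦ j).cuspForm := by
    rw [Fintype.linearIndependent_iff]
    intro c hc
    have hBS : MDiff B := hB.mdifferentiable
    have hCS : MDiff C := hC.mdifferentiable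
    let c' : ℕ → ℂ := fun j ↦ if h : j < n then c ⟨j, h⟩ else 0
    have h1 : (F * C) * ∑ j ∈ Finset.range n, c' j • (B ^ j * C ^ (n - 1 - j)) = 0 := by
      rw [Finset.mul_sum, Finset.sum_range]
      ext τ
      have := DFunLike.congr_fun hc τ
      simpa [FunLike.coe_sum, c'] using this
    have h2 : ∑ j ∈ Finset.range n, c' j • (B ^ j * C ^ (n - 1 - j)) = 0 := by
      refine ((UpperHalfPlane.mul_eq_zero_iff (hF.mul hC).mdifferentiable ?_).mp h1).resolve_left ?_
      · exact .sum fun j _ ↦ ((hBS.pow j).mul (hCS.pow _)).const_smul _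
      · rw [UpperHalfPlane.mul_eq_zero_iff hF.mdifferentiable hCS, not_or]
        exact ⟨hF.ne_zero_of_right hone, hC.ne_zero_of_left (by norm_num)⟩
    have h3 := sum_mul_pow_eq_zero hBS (hB.ne_zero_of_right (by norm_num)) hB.tendsto hCS
      (by norm_num) hC.tendsto h2
    intro i
    simpa [c'] using h3 i i.2
  simpa using hli.fintype_card_le_finrank

/-- The dimension of `S_k(Γ₀(2))` for even `k`. -/
theorem finrank_levelTwo {k : ℤ} (hk : Even k) :
    Module.finrank ℂ (LevelTwo k) = k.toNat / 4 - 1 := by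
  refine (finrank_levelTwo_le k).antisymm ?_
  rcases Nat.eq_zero_or_pos (k.toNat / 4 - 1) with h | h
  · rw [h]
    exact Nat.zero_le _
  · obtain ⟨m, rfl⟩ := hk
    -- The starting weight `k₀` is `4` or `6` according to `k` modulo `4`.
    rcases Nat.even_or_odd m.toNat with h2 | h2
    · exact le_finrank_levelTwo (k₀ := 4) (by norm_num) (by decide) (by
        obtain ⟨r, hr⟩ := h2; lia)
    · exact le_finrank_levelTwo (k₀ := 6) (by norm_num) (by decide) (by
        obtain ⟨r, hr⟩ := h2; lia)

/-- The dimension of `S_k(SL₂(ℤ))` for even `k`. -/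
theorem dimOne_eq {k : ℤ} (hk : Even k) :
    dimOne k = if k.toNat % 12 = 2 then k.toNat / 12 - 1 else k.toNat / 12 := by
  -- Division by `Δ` identifies `S_k` with the modular forms of weight `k - 12`.
  rw [dimOne, CuspForm.discriminantEquiv.finrank_eq]
  rcases lt_or_ge k 12 with h | h
  · rw [Module.finrank, ModularForm.levelOne_neg_weight_rank_zero (by lia)]
    rw [show k.toNat / 12 = 0 by lia]
    simp
  · obtain ⟨n, rfl⟩ : ∃ n : ℕ, k = n + 12 := ⟨(k - 12).toNat, by lia⟩
    have hn : Even n := by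
      have := hk.sub (show Even (12 : ℤ) by decide)
      simpa using this
    rw [add_sub_cancel_right, Module.finrank, ModularForm.dimension_level_one n hn]
    rw [show ((n : ℤ) + 12).toNat = n + 12 by lia]
    simp only [Nat.ModEq]
    split_ifs <;> simp <;> lia

end Ghost
end

/-! ### Old and new subspaces -/

noncomputable section

open UpperHalfPlane Filter Asymptotics CongruenceSubgroup ModularForm ModularGroup MeasureTheory
open scoped Pointwise MatrixGroups Modular Topology Manifold Real ModularForm

namespace Ghost

lemma tendsto_zero_levelOne {k : ℤ} (g : LevelOne k) : Tendsto g atImInfty (𝓝 0) :=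
  CuspFormClass.zero_at_infty g

/-- A cusp form of level one, as a cusp form on `Γ₀(2)`. -/
def ofLevelOne {k : ℤ} (g : LevelOne k) : LevelTwo k :=
  (hasCuspValues_levelOne (tendsto_zero_levelOne g)).cuspForm

/-- The form `g(2τ)` on `Γ₀(2)`. -/
def doubleLevelOne {k : ℤ} (g : LevelOne k) : LevelTwo k :=
  HasCuspValues.cuspForm (f := fun τ ↦ g (double τ)) (by
    simpa using hasCuspValues_comp_double (tendsto_zero_levelOne g))

@[simp]
lemma ofLevelOne_apply {k : ℤ} (g : LevelOne k) (τ : ℍ) : ofLevelOne g τ = g τ := rfl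

@[simp]
lemma doubleLevelOne_apply {k : ℤ} (g : LevelOne k) (τ : ℍ) :
    doubleLevelOne g τ = g (double τ) := rfl

/-- The map `(g, h) ↦ g(τ) + h(2τ)`. -/
def oldMap (k : ℤ) : LevelOne k × LevelOne k →ₗ[ℂ] LevelTwo k where
  toFun p := ofLevelOne p.1 + doubleLevelOne p.2
  map_add' p q := by
    ext τ
    simp
    ring
  map_smul' c p := by
    ext τ
    simp

lemma oldSubspace_eq_range (k : ℤ) : oldSubspace k = LinearMap.range (oldMap k) := by
  apply le_antisymm
  · refine Submodule.span_le.mpr ?_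
    rintro f ⟨g, hg | hg⟩
    · exact ⟨(g, 0), by ext τ; simp [oldMap, hg]⟩
    · exact ⟨(0, g), by ext τ; simp [oldMap, hg]⟩
  · rintro _ ⟨p, rfl⟩
    exact add_mem (Submodule.subset_span ⟨p.1, .inl fun _ ↦ rfl⟩)
      (Submodule.subset_span ⟨p.2, .inr fun _ ↦ rfl⟩)

/-- Applying `S` to `g(τ) = h(2τ)` gives `g(τ) = 2^(-k) h(τ/2)`, hence `g(τ) = 2^k g(4τ)`. So `|g|²
y^k` is invariant under `τ ↦ 4τ`; since it tends to zero at infinity, it vanishes. -/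
lemma eq_zero_of_eq_comp_double {k : ℤ} {g h : LevelOne k} (H : ∀ τ, g τ = h (double τ)) :
    g = 0 := by
  have hS (τ : ℍ) : g τ = 2 ^ (-k) * h (halve τ) := by
    have h1 := congrFun (comp_double_slash_S (slash_eq_levelOne h S)) τ
    rw [show (fun τ ↦ h (double τ)) = ⇑g from funext fun τ ↦ (H τ).symm, slash_eq_levelOne] at h1
    exact h1
  have h4 (τ : ℍ) : g τ = 2 ^ k * g (double (double τ)) := by
    rw [H τ, hS (double (double τ)), halve_double, ← mul_assoc, ← zpow_add₀ two_ne_zero]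
    simp
  have hP (τ : ℍ) : petersson k g g (double (double τ)) = petersson k g g τ := by
    have h2 : (2 : ℂ) ^ k ≠ 0 := zpow_ne_zero _ two_ne_zero
    simp only [petersson, im_double]
    rw [h4 τ, map_mul, map_zpow₀, Complex.conj_ofNat]
    push_cast
    rw [mul_zpow, mul_zpow]
    ring
  have hzero := (CuspFormClass.zero_at_infty g).petersson_isZeroAtImInfty_left k 𝒮ℒ g
  have htends (τ : ℍ) : Tendsto (fun n : ℕ ↦ (double ∘ double)^[n] τ) atTop atImInfty := by
    have him (n : ℕ) : ((double ∘ double)^[n] τ).im = 4 ^ n * τ.im := by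
      induction n with
      | zero => simp
      | succ n ih =>
        rw [Function.iterate_succ_apply', Function.comp_apply, im_double, im_double, ih]
        ring
    rw [atImInfty, tendsto_comap_iff]
    exact ((tendsto_pow_atTop_atTop_of_one_lt (by norm_num : (1 : ℝ) < 4)).atTop_mul_const
      τ.im_pos).congr fun n ↦ (him n).symm
  ext τ
  have hconst (n : ℕ) : petersson k g g ((double ∘ double)^[n] τ) = petersson k g g τ := by
    induction n with
    | zero => rfl
    | succ n ih => rw [Function.iterate_succ_apply', Function.comp_apply, hP, ih]
  have h0 : petersson k g g τ = 0 := by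
    refine tendsto_nhds_unique (f := fun n : ℕ ↦ petersson k g g ((double ∘ double)^[n] τ)) ?_
      (hzero.comp (htends τ))
    simp only [hconst]
    exact tendsto_const_nhds
  have him : (τ.im : ℂ) ^ k ≠ 0 := zpow_ne_zero _ (Complex.ofReal_ne_zero.mpr τ.im_ne_zero)
  simpa [petersson, him] using h0

lemma oldMap_injective (k : ℤ) : Function.Injective (oldMap k) := by
  rw [injective_iff_map_eq_zero]
  rintro ⟨g, h⟩ H
  have h1 (τ : ℍ) : g τ = (-h) (double τ) := by
    have := DFunLike.congr_fun H τ
    simpa [oldMap, add_eq_zero_iff_eq_neg] using this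
  have hg := eq_zero_of_eq_comp_double h1
  have hh : h = 0 := by
    ext τ
    have := h1 (halve τ)
    have hd : double (halve τ) = τ := by ext; simp
    rw [hd, hg] at this
    simpa using this
  rw [hg, hh]; rfl

instance (k : ℤ) : FiniteDimensional ℂ (LevelOne k) :=
  .of_injective CuspForm.discriminantEquiv.toLinearMap CuspForm.discriminantEquiv.injective

theorem finrank_oldSubspace (k : ℤ) : Module.finrank ℂ (oldSubspace k) = 2 * dimOne k := by
  rw [oldSubspace_eq_range, LinearMap.finrank_range_of_inj (oldMap_injective k),
    Module.finrank_prod, dimOne, two_mul]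

/-! ### The Petersson product -/

/-- The domain lies in the strip `|x| ≤ 1/2`, `y > 1/2`, over which `dx dy / y²` has finite
integral. -/
lemma volume_fd_lt_top : volume 𝒟 < ⊤ := by
  rw [volume_eq_lintegral]
  let s : Set (ℝ × ℝ) := Set.Icc (-(1 / 2)) (1 / 2) ×ˢ Set.Ioi (1 / 2)
  have hsub : ((↑) '' 𝒟 : Set ℂ) ⊆ Complex.measurableEquivRealProd ⁻¹' s := by
    rintro _ ⟨τ, hτ, rfl⟩
    have h1 := hτ.1
    have h2 := abs_le.mp hτ.2
    refine ⟨by simpa using h2, ?_⟩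
    rw [Complex.normSq_apply] at h1
    simp only [coe_re, coe_im] at h1
    have := τ.im_pos
    simp only [Complex.measurableEquivRealProd_apply, Set.mem_Ioi, coe_im]
    nlinarith [h2.1, h2.2]
  refine (lintegral_mono_set hsub).trans_lt ?_
  have hmp := Complex.volume_preserving_equiv_real_prod
  have := hmp.setLIntegral_comp_preimage_emb Complex.measurableEquivRealProd.measurableEmbedding
    (fun p : ℝ × ℝ ↦ (((1 / ‖p.2‖₊) ^ 2 : NNReal) : ENNReal)) s
  simp only [Complex.measurableEquivRealProd_apply] at this
  rw [this, Measure.volume_eq_prod, ← Measure.prod_restrict,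
    lintegral_prod _ (by fun_prop)]
  simp only [lintegral_const]
  refine ENNReal.mul_lt_top ?_ (by simp)
  have hint : IntegrableOn (fun y : ℝ ↦ y ^ (-2 : ℝ)) (Set.Ioi (1 / 2)) :=
    integrableOn_Ioi_rpow_of_lt (by norm_num) (by norm_num)
  refine lt_of_eq_of_lt (setLIntegral_congr_fun measurableSet_Ioi fun y hy ↦ ?_) hint.2
  have hy0 : 0 < y := lt_trans (by norm_num) hy
  rw [enorm_eq_nnnorm]
  congr 1
  ext
  simp [Real.rpow_neg hy0.le, abs_of_pos hy0]

lemma volume_fundDomain_lt_top : volume fundDomain < ⊤ := by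
  have h : fundDomain ⊆ ⋃ γ ∈ ({1, S, S * T} : Finset SL(2, ℤ)),
      (Matrix.SpecialLinearGroup.mapGL ℝ γ) • 𝒟 := by
    rintro _ ⟨γ, hγ, σ, hσ, rfl⟩
    refine Set.mem_iUnion₂.mpr ⟨γ, by simpa using hγ, Set.smul_mem_smul_set hσ⟩
  refine (measure_mono h).trans_lt ((measure_biUnion_finset_le _ _).trans_lt ?_)
  refine ENNReal.sum_lt_top.mpr fun γ _ ↦ ?_
  rw [measure_smul]
  exact volume_fd_lt_top

lemma integrableOn_petersson {k : ℤ} (f g : LevelTwo k) :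
    IntegrableOn (petersson k f g) fundDomain := by
  obtain ⟨C, hC⟩ := CuspFormClass.petersson_bounded_left k
    ((Gamma0 2).map (Matrix.SpecialLinearGroup.mapGL ℝ)) f g
  refine IntegrableOn.of_bound volume_fundDomain_lt_top ?_ C (.of_forall hC)
  exact (petersson_continuous k (ModularFormClass.continuous f)
    (ModularFormClass.continuous g)).aestronglyMeasurable

lemma volume_ne_zero_of_isOpen {U : Set ℍ} (hU : IsOpen U) (hne : U.Nonempty) :
    volume U ≠ 0 := by
  rw [volume_def, Ne, withDensity_apply_eq_zero (by fun_prop), measurableEmbedding_coe.comap_apply]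
  have hS : {τ : ℍ | (((1 / NNReal.mk τ.im τ.im_pos.le) ^ 2 : NNReal) : ENNReal) ≠ 0} = Set.univ := by
    ext τ
    have : (NNReal.mk τ.im τ.im_pos.le)⁻¹ ≠ 0 := inv_ne_zero (NNReal.ne_iff.mp τ.im_ne_zero)
    simpa using this
  rw [hS, Set.univ_inter]
  exact ((isOpenEmbedding_coe.isOpenMap U hU).measure_pos volume (hne.image _)).ne'

lemma petersson_self (k : ℤ) (f : ℍ → ℂ) (τ : ℍ) :
    petersson k f f τ = ((‖f τ‖ ^ 2 * τ.im ^ k : ℝ) : ℂ) := by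
  rw [petersson, Complex.conj_mul']
  push_cast
  rfl

lemma norm_sq_mul_im_zpow_nonneg (k : ℤ) (f : ℍ → ℂ) (τ : ℍ) : 0 ≤ ‖f τ‖ ^ 2 * τ.im ^ k :=
  mul_nonneg (sq_nonneg _) (zpow_nonneg τ.im_pos.le _)

lemma peterssonProduct_self {k : ℤ} (f : LevelTwo k) :
    peterssonProduct k f f = ((∫ τ in fundDomain, ‖f τ‖ ^ 2 * τ.im ^ k : ℝ) : ℂ) := by
  simp only [peterssonProduct, petersson_self, integral_complex_ofReal]

lemma fdo_subset_fundDomain : 𝒟ᵒ ⊆ fundDomain := fun τ hτ ↦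
  ⟨1, by simp, τ, fdo_subset_fd hτ, by simp⟩

/-- A zero integral makes `f` vanish almost everywhere on the open set `𝒟ᵒ`, hence everywhere there
by continuity, and then on `ℍ` by the identity theorem. -/
lemma eq_zero_of_peterssonProduct_self {k : ℤ} {f : LevelTwo k}
    (h : peterssonProduct k f f = 0) : f = 0 := by
  rw [peterssonProduct_self, Complex.ofReal_eq_zero] at h
  have hint : IntegrableOn (fun τ : ℍ ↦ ‖f τ‖ ^ 2 * τ.im ^ k) fundDomain :=
    (integrableOn_petersson f f).re.congr (.of_forall fun τ ↦ by
      simp only [petersson_self]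
      exact Complex.ofReal_re _)
  have hae := (integral_eq_zero_iff_of_nonneg (norm_sq_mul_im_zpow_nonneg k f) hint).mp h
  have hae' : ∀ᵐ τ ∂(volume.restrict 𝒟ᵒ), ‖f τ‖ ^ 2 * τ.im ^ k = 0 :=
    ae_mono (Measure.restrict_mono fdo_subset_fundDomain le_rfl) hae
  rw [ae_restrict_iff' isOpen_fdo.measurableSet] at hae'
  have hzero (τ : ℍ) (hτ : τ ∈ 𝒟ᵒ) : f τ = 0 := by
    by_contra hne
    have hopen : IsOpen (𝒟ᵒ ∩ {τ | f τ ≠ 0}) :=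
      isOpen_fdo.inter (isOpen_ne_fun (ModularFormClass.continuous f) continuous_const)
    refine volume_ne_zero_of_isOpen hopen ⟨τ, hτ, hne⟩ (measure_mono_null ?_ hae')
    rintro z ⟨hz, hfz⟩ H
    have := H hz
    simp only [mul_eq_zero, zpow_ne_zero k z.im_ne_zero, or_false] at this
    exact hfz (by simpa using this)
  -- The point `2i` is interior; `i` itself lies on the boundary arc.
  have hI : (double UpperHalfPlane.I) ∈ 𝒟ᵒ := by
    constructor <;> simp [Complex.normSq_apply, double]
    all_goals norm_num
  refine DFunLike.coe_injective (eq_zero_of_frequently (τ := double UpperHalfPlane.I) f.holo' ?_)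
  refine Eventually.frequently ?_
  exact eventually_nhdsWithin_of_eventually_nhds
    (eventually_of_mem (isOpen_fdo.mem_nhds hI) hzero)

/-- The Petersson product on `S_k(Γ₀(2))` as an inner product. -/
abbrev peterssonCore (k : ℤ) : InnerProductSpace.Core ℂ (LevelTwo k) where
  inner := peterssonProduct k
  conj_inner_symm f g := by
    simp only [peterssonProduct, ← integral_conj]
    congr 1
    ext τ
    rw [petersson_symm k f g, Complex.conj_conj]
  re_inner_nonneg f := by
    rw [peterssonProduct_self]
    exact integral_nonneg (norm_sq_mul_im_zpow_nonneg k f)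
  add_left f g h := by
    simp only [peterssonProduct]
    rw [← integral_add (integrableOn_petersson f h) (integrableOn_petersson g h)]
    congr 1
    ext τ
    simp [petersson]
    ring
  smul_left f g c := by
    simp only [peterssonProduct]
    rw [← integral_const_mul]
    congr 1
    ext τ
    simp [petersson]
    ring
  definite f := eq_zero_of_peterssonProduct_self

theorem dimNew_add (k : ℤ) : dimNew k + 2 * dimOne k = Module.finrank ℂ (LevelTwo k) := by
  let := (peterssonCore k).toNormedAddCommGroup
  let : InnerProductSpace ℂ (LevelTwo k) := .ofCore (peterssonCore k).toCore
  have h : newSubspace k = (oldSubspace k)ᗮ := by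
    rw [newSubspace, ← Submodule.span_eq (oldSubspace k)ᗮ]
    congr 1
  rw [dimNew, h, ← finrank_oldSubspace, add_comm]
  exact (oldSubspace k).finrank_add_finrank_orthogonal

end Ghost
end

/-! ### Weight coordinates, multiplicities and the valuation identity -/

noncomputable section
namespace Ghost

/-! ### Powers of a topological generator -/

/-- The units of `ℤ₂` congruent to `1` modulo `8`. -/
def unitsOneModEight : Subgroup ℤ_[2]ˣ where
  carrier := {u | ‖(u : ℤ_[2]) - 1‖ ≤ 8⁻¹}
  one_mem' := by simp
  mul_mem' {u v} hu hv := by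
    rw [Set.mem_ofPred_eq, Units.val_mul,
      show (u * v : ℤ_[2]) - 1 = u * (v - 1) + (u - 1) by ring]
    refine (PadicInt.nonarchimedean _ _).trans (max_le ?_ hu)
    simpa using hv
  inv_mem' {u} hu := by
    rw [Set.mem_ofPred_eq,
      show ((u⁻¹ : ℤ_[2]ˣ) : ℤ_[2]) - 1 = -((u⁻¹ : ℤ_[2]ˣ) * (u - 1)) by
        rw [mul_sub, Units.inv_mul]; ring]
    simpa using hu

lemma norm_two_padicInt : ‖(2 : ℤ_[2])‖ = 2⁻¹ := by
  simpa using PadicInt.norm_p (p := 2)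

lemma norm_four_padicInt : ‖(4 : ℤ_[2])‖ = 4⁻¹ := by
  rw [show (4 : ℤ_[2]) = 2 * 2 by norm_num, norm_mul, norm_two_padicInt]
  norm_num

/-- If `γ` were `1` modulo `8`, its powers would stay in the closed subgroup of units congruent to
`1` modulo `8`, which misses `5`. -/
lemma norm_sub_one_of_isTopGenerator {γ : ℤ_[2]ˣ} (hγ : IsTopGenerator γ) :
    ‖(γ : ℤ_[2]) - 1‖ = 4⁻¹ := by
  have hmem : γ ∈ ((Subgroup.zpowers γ).topologicalClosure : Set ℤ_[2]ˣ) :=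
    Subgroup.le_topologicalClosure _ (Subgroup.mem_zpowers γ)
  rw [hγ] at hmem
  obtain ⟨x, hx⟩ := hmem
  have hnorm : ‖(γ : ℤ_[2]) - 1‖ = 4⁻¹ * ‖x‖ := by
    rw [hx, add_sub_cancel_left, norm_mul, norm_four_padicInt]
  rcases (PadicInt.norm_le_one x).lt_or_eq with hlt | heq
  swap
  · rw [hnorm, heq, mul_one]
  exfalso
  obtain ⟨y, rfl⟩ : (2 : ℤ_[2]) ∣ x := by simpa using! (PadicInt.norm_lt_one_iff_dvd x).mp hlt
  have hγ8 : γ ∈ unitsOneModEight := by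
    change ‖(γ : ℤ_[2]) - 1‖ ≤ 8⁻¹
    rw [hnorm, norm_mul, norm_two_padicInt]
    linarith [PadicInt.norm_le_one y]
  have hclosed : IsClosed (unitsOneModEight : Set ℤ_[2]ˣ) :=
    isClosed_le (f := fun u : ℤ_[2]ˣ ↦ ‖(u : ℤ_[2]) - 1‖) (by fun_prop) continuous_const
  have hle : (Subgroup.zpowers γ).topologicalClosure ≤ unitsOneModEight :=
    Subgroup.topologicalClosure_minimal _ (by simpa using hγ8) hclosed
  have h5 : ‖(1 + 4 * 1 : ℤ_[2])‖ = 1 := by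
    rw [PadicInt.norm_add_eq_max_of_ne] <;> norm_num [norm_four_padicInt]
  obtain ⟨u, hu⟩ := PadicInt.isUnit_iff.mpr h5
  have hmem : u ∈ unitsOneModEight := by
    apply hle
    rw [← SetLike.mem_coe, hγ]
    exact ⟨1, hu⟩
  change ‖(u : ℤ_[2]) - 1‖ ≤ 8⁻¹ at hmem
  rw [hu, add_sub_cancel_left, mul_one, norm_four_padicInt] at hmem
  norm_num at hmem

/-- Strong induction on `n`: doubling the exponent multiplies by `x^m + 1`, which is `2` modulo `4`;
for odd `n` the term `x - 1` dominates `x (x^(n-1) - 1)`. -/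
lemma norm_pow_sub_one {x : ℤ_[2]} (hx : ‖x - 1‖ = 4⁻¹) (n : ℕ) :
    ‖x ^ n - 1‖ = ‖(n : ℤ_[2])‖ * 4⁻¹ := by
  induction n using Nat.strong_induction_on with | _ n ih =>
  rcases Nat.even_or_odd' n with ⟨m, rfl | rfl⟩
  · rcases Nat.eq_zero_or_pos m with rfl | hm
    · simp
    have h1 := ih m (by lia)
    have h2 : ‖x ^ m + 1‖ = 2⁻¹ := by
      have h3 : ‖x ^ m - 1‖ < ‖(2 : ℤ_[2])‖ := by
        rw [h1, norm_two_padicInt]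
        linarith [PadicInt.norm_le_one (m : ℤ_[2])]
      rw [show x ^ m + 1 = (x ^ m - 1) + 2 by ring, PadicInt.norm_add_eq_max_of_ne h3.ne,
        max_eq_right h3.le, norm_two_padicInt]
    rw [show x ^ (2 * m) - 1 = (x ^ m - 1) * (x ^ m + 1) by ring, norm_mul, h1, h2]
    push_cast
    rw [norm_mul, norm_two_padicInt]
    ring
  · have hodd : ‖((2 * m + 1 : ℕ) : ℤ_[2])‖ = 1 := by
      have h3 : ‖(2 * m : ℤ_[2])‖ < ‖(1 : ℤ_[2])‖ := by
        rw [norm_mul, norm_two_padicInt, norm_one]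
        linarith [PadicInt.norm_le_one (m : ℤ_[2])]
      push_cast
      rw [PadicInt.norm_add_eq_max_of_ne h3.ne, max_eq_right h3.le, norm_one]
    rw [hodd, one_mul]
    rcases Nat.eq_zero_or_pos m with rfl | hm
    · simpa using hx
    have hsq : ‖x ^ (2 * m) - 1‖ < ‖x - 1‖ := by
      have h1 := ih (2 * m) (by lia)
      rw [h1, hx]
      push_cast
      rw [norm_mul, norm_two_padicInt]
      linarith [PadicInt.norm_le_one (m : ℤ_[2])]
    have hxn : ‖x‖ = 1 := by
      have h3 : ‖x - 1‖ < ‖(1 : ℤ_[2])‖ := by rw [hx]; norm_num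
      rw [show x = (x - 1) + 1 by ring, PadicInt.norm_add_eq_max_of_ne h3.ne, max_eq_right h3.le,
        norm_one]
    have hmul : ‖x * (x ^ (2 * m) - 1)‖ < ‖x - 1‖ := by rwa [norm_mul, hxn, one_mul]
    rw [show x ^ (2 * m + 1) - 1 = x * (x ^ (2 * m) - 1) + (x - 1) by ring,
      PadicInt.norm_add_eq_max_of_ne hmul.ne, max_eq_right hmul.le, hx]

lemma norm_weightCoord_sub {γ : ℤ_[2]ˣ} (hγ : IsTopGenerator γ) (k : ℤ) (n : ℕ) :
    ‖weightCoord γ k - weightCoord γ (k + n)‖ = ‖(n : ℤ_[2])‖ * 4⁻¹ := by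
  rw [← norm_pow_sub_one (norm_sub_one_of_isTopGenerator hγ), weightCoord, weightCoord, zpow_add,
    zpow_natCast, Units.val_mul, Units.val_pow_eq_pow_val,
    show (((γ ^ k : ℤ_[2]ˣ) : ℤ_[2]) - 1 - (((γ ^ k : ℤ_[2]ˣ) : ℤ_[2]) * (γ : ℤ_[2]) ^ n - 1))
      = -(((γ ^ k : ℤ_[2]ˣ) : ℤ_[2]) * ((γ : ℤ_[2]) ^ n - 1)) by ring, norm_neg, norm_mul]
  simp

/-! ### Multiplicities -/

lemma dimNew_eq {k : ℤ} (hk : Even k) : dimNew k = k.toNat / 4 - 1 - 2 * dimOne k := by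
  have := dimNew_add k
  rw [finrank_levelTwo hk] at this
  lia

lemma dimOne_two_mul (m : ℕ) : dimOne (2 * m) = if m % 6 = 1 then m / 6 - 1 else m / 6 := by
  rw [dimOne_eq (even_two_mul _), show (2 * (m : ℤ)).toNat = 2 * m by lia]
  split_ifs <;> lia

lemma dimNew_two_mul (m : ℕ) : dimNew (2 * m) = m / 2 - 1 - 2 * dimOne (2 * m) := by
  rw [dimNew_eq (even_two_mul _)]
  lia

lemma mult_eq_zero_of_nonpos {k : ℤ} (hk : Even k) (hk0 : k ≤ 0) (i : ℕ) : mult i k = 0 := by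
  rw [mult, dimNew_eq hk, show k.toNat = 0 by lia]
  simp only [shiftedPattern, pattern]
  split_ifs <;> lia

/-- From `m = 6i + 2` on, `d_{2m} ≥ i`, so the tent starts after index `i`. -/
lemma mult_two_mul_eq_zero {i m : ℕ} (hm : 6 * i + 2 ≤ m) : mult i (2 * m) = 0 := by
  rw [mult, shiftedPattern, if_neg]
  rw [dimOne_two_mul]
  split_ifs <;> lia

lemma mult_zero (k : ℤ) : mult 0 k = 0 := by
  simp [mult, shiftedPattern]

/-- Here `n` plays the role of `d_k^new`. The tent of length `n - 1` climbs, then descends, with one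
flat step in the middle when `n` is odd; the formula also covers the truncated case `n = 0`. -/
lemma pattern_sub (n j : ℕ) (hj : 1 ≤ j) :
    (pattern (n - 1) j : ℤ) - pattern (n - 1) (j - 1) =
      (if j ≤ n / 2 then 1 else 0) - (if (n + 1) / 2 < j ∧ j ≤ n then 1 else 0) := by
  simp only [pattern]
  split_ifs <;> lia

lemma shiftedPattern_sub (n d j : ℕ) (hj : 1 ≤ j) :
    (shiftedPattern (n - 1) d j : ℤ) - shiftedPattern (n - 1) d (j - 1) =
      (if d < j ∧ j ≤ d + n / 2 then 1 else 0) -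
      (if d + (n + 1) / 2 < j ∧ j ≤ d + n then 1 else 0) := by
  rcases Nat.lt_or_ge d j with h | h
  · have h1 : shiftedPattern (n - 1) d (j - 1) = pattern (n - 1) (j - d - 1) := by
      rcases Nat.lt_or_ge d (j - 1) with h' | h'
      · rw [shiftedPattern, if_pos h', show j - 1 - d = j - d - 1 by lia]
      · rw [shiftedPattern, if_neg (by lia), show j - d - 1 = 0 by lia]
        simp [pattern]
    rw [h1, shiftedPattern, if_pos h, pattern_sub n (j - d) (by lia)]
    congr 2 <;> rw [eq_iff_iff] <;> lia
  · simp only [shiftedPattern]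
    split_ifs <;> lia

/-- The conditions on `j` from `shiftedPattern_sub` are solved for `m` by the dimension formulas.
The ascending range omits `6j`, because `d_{12j} = j` whereas `d_{12j+2} = j - 1`. -/
lemma mult_sub (j m : ℕ) (hj : 1 ≤ j) :
    (mult j (2 * m) : ℤ) - mult (j - 1) (2 * m) =
      (if m ∈ (Finset.Ioc (4 * j + 1) (6 * j + 1)).erase (6 * j) then 1 else 0) -
      (if m ∈ Finset.Ioc (3 * j) (4 * j - 1) then 1 else 0) := by
  rw [mult, mult, shiftedPattern_sub _ _ _ hj, dimNew_two_mul, dimOne_two_mul]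
  congr 2
  · rw [eq_iff_iff, Finset.mem_erase, Finset.mem_Ioc]
    split_ifs <;> lia
  · rw [eq_iff_iff, Finset.mem_Ioc]
    split_ifs <;> lia

/-! ### Valuations -/

lemma finite_setOf_mult_ne_zero (i : ℕ) : {k : ℤ | Even k ∧ mult i k ≠ 0}.Finite := by
  refine (Set.finite_Icc (0 : ℤ) (2 * (6 * i + 2))).subset ?_
  rintro k ⟨hk, hm⟩
  have hpos : 0 < k := by
    by_contra! h
    exact hm (mult_eq_zero_of_nonpos hk h i)
  obtain ⟨m, rfl⟩ : ∃ m : ℕ, k = 2 * m := ⟨k.toNat / 2, by obtain ⟨r, rfl⟩ := hk; lia⟩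
  have : m < 6 * i + 2 := by
    by_contra! h
    exact hm (mult_two_mul_eq_zero h)
  constructor <;> lia

lemma eval_ghostCoeff (γ : ℤ_[2]ˣ) (i : ℕ) (x : ℤ_[2]) :
    (ghostCoeff γ i).eval x =
      ∏ m ∈ Finset.range (6 * i + 2), (x - weightCoord γ (2 * m)) ^ mult i (2 * m) := by
  let e : ℕ ↪ {k : ℤ // Even k} := ⟨fun m ↦ ⟨2 * m, even_two_mul _⟩, fun a b h ↦ by
    have := congrArg Subtype.val h
    simpa using this⟩
  rw [ghostCoeff, finprod_eq_prod_of_mulSupport_subset (s := (Finset.range (6 * i + 2)).map e),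
    Finset.prod_map, Polynomial.eval_prod]
  · refine Finset.prod_congr rfl fun m _ ↦ ?_
    change Polynomial.eval x ((Polynomial.X - Polynomial.C (weightCoord γ (2 * m))) ^
      mult i (2 * m)) = _
    simp
  · rintro ⟨k, hk⟩ hmem
    have hm : mult i k ≠ 0 := fun h ↦ hmem (by simp [h])
    have hpos : 0 < k := by
      by_contra! h
      exact hm (mult_eq_zero_of_nonpos hk h i)
    obtain ⟨m, rfl⟩ : ∃ m : ℕ, k = 2 * m := ⟨k.toNat / 2, by obtain ⟨r, rfl⟩ := hk; lia⟩
    have : m < 6 * i + 2 := by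
      by_contra! h
      exact hm (mult_two_mul_eq_zero h)
    simp only [Finset.coe_map, Finset.coe_range, Set.mem_image, Set.mem_Iio]
    exact ⟨m, this, rfl⟩

lemma valuation_weightCoord_sub {γ : ℤ_[2]ˣ} (hγ : IsTopGenerator γ) {N m : ℕ} (h : m + N ≠ 0) :
    weightCoord γ (-(2 * N : ℕ)) - weightCoord γ (2 * m) ≠ 0 ∧
    ((weightCoord γ (-(2 * N : ℕ)) - weightCoord γ (2 * m) : ℤ_[2]) : ℚ_[2]).valuation =
      3 + padicValNat 2 (m + N) := by
  have hnorm := norm_weightCoord_sub hγ (-(2 * N : ℕ)) (2 * (m + N))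
  rw [show (-(2 * N : ℕ) : ℤ) + (2 * (m + N) : ℕ) = 2 * m by push_cast; ring] at hnorm
  have hne : ((m + N : ℕ) : ℤ_[2]) ≠ 0 := Nat.cast_ne_zero.mpr h
  set x := weightCoord γ (-(2 * N : ℕ)) - weightCoord γ (2 * m)
  have hx : ‖x‖ = ‖((8 * (m + N) : ℕ) : ℤ_[2])‖ := by
    rw [hnorm]
    push_cast
    rw [show (8 : ℤ_[2]) = 2 * 4 by norm_num, norm_mul, norm_mul, norm_mul, norm_four_padicInt]
    ring
  have hx0 : x ≠ 0 := by
    rw [← norm_ne_zero_iff, hx, norm_ne_zero_iff]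
    exact Nat.cast_ne_zero.mpr (by lia)
  refine ⟨hx0, ?_⟩
  have hx' : ‖(x : ℚ_[2])‖ = ‖((8 * (m + N) : ℕ) : ℚ_[2])‖ := by
    rw [← PadicInt.norm_def, hx, PadicInt.norm_def, PadicInt.coe_natCast]
  rw [Padic.norm_eq_zpow_neg_valuation (PadicInt.coe_ne_zero.mpr hx0),
    Padic.norm_eq_zpow_neg_valuation (Nat.cast_ne_zero.mpr (by lia)),
    zpow_right_inj₀ (by norm_num) (by norm_num), neg_inj, Padic.valuation_natCast,
    padicValNat.mul (by norm_num) h, show 8 = 2 ^ 3 by norm_num, padicValNat.prime_pow] at hx'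
  exact_mod_cast hx'

lemma valuation_eval_ghostCoeff {γ : ℤ_[2]ˣ} (hγ : IsTopGenerator γ) (N i : ℕ) :
    (ghostCoeff γ i).eval (weightCoord γ (-(2 * N : ℕ))) ≠ 0 ∧
    (((ghostCoeff γ i).eval (weightCoord γ (-(2 * N : ℕ))) : ℤ_[2]) : ℚ_[2]).valuation =
      ∑ m ∈ Finset.range (6 * i + 2), mult i (2 * m) * (3 + padicValNat 2 (m + N) : ℤ) := by
  rw [eval_ghostCoeff]
  have key (m : ℕ) :
      (weightCoord γ (-(2 * N : ℕ)) - weightCoord γ (2 * m)) ^ mult i (2 * m) ≠ 0 ∧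
      (((weightCoord γ (-(2 * N : ℕ)) - weightCoord γ (2 * m)) ^ mult i (2 * m) : ℤ_[2]) :
        ℚ_[2]).valuation = mult i (2 * m) * (3 + padicValNat 2 (m + N) : ℤ) := by
    rcases Nat.eq_zero_or_pos m with rfl | hm
    -- For `N = 0` the base `w_0 - w_0` is zero, but its exponent is zero too, so the factor is `1`.
    · rw [mult_eq_zero_of_nonpos (by simp) (by simp)]
      simp
    · obtain ⟨h1, h2⟩ := valuation_weightCoord_sub hγ (N := N) (m := m) (by lia)
      refine ⟨pow_ne_zero _ h1, ?_⟩
      rw [PadicInt.coe_pow, Padic.valuation_pow, h2]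
  generalize Finset.range (6 * i + 2) = s
  induction s using Finset.induction_on with
  | empty => simp
  | insert m s hm ih =>
    rw [Finset.prod_insert hm, Finset.sum_insert hm]
    refine ⟨mul_ne_zero (key m).1 ih.1, ?_⟩
    rw [PadicInt.coe_mul, Padic.valuation_mul, (key m).2, ih.2]
    · exact PadicInt.coe_ne_zero.mpr (key m).1
    · exact PadicInt.coe_ne_zero.mpr ih.1

lemma padicValNat_factorial_eq_add_sum (N : ℕ) {a b : ℕ} (hab : a ≤ b) :
    (padicValNat 2 (N + b).factorial : ℤ) =
      padicValNat 2 (N + a).factorial + ∑ m ∈ Finset.Ioc a b, (padicValNat 2 (m + N) : ℤ) := by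
  induction b, hab using Nat.le_induction with
  | base => simp
  | succ b hb ih =>
    rw [Finset.sum_Ioc_succ_top (by lia), ← add_assoc (padicValNat 2 (N + a).factorial : ℤ), ← ih,
      ← add_assoc N, Nat.factorial_succ,
      padicValNat.mul (by lia) (Nat.factorial_ne_zero _)]
    rw [show b + 1 + N = N + b + 1 by ring, Nat.cast_add]
    ring

lemma padicValNat_factorial_two_mul (n : ℕ) :
    padicValNat 2 (2 * n).factorial = n + padicValNat 2 n.factorial := by
  rw [padicValNat_factorial_mul, add_comm]

/-- The valuation of the `j`-th factor of the Buzzard–Calegari product. -/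
lemma padicValRat_bcFactor (N j : ℕ) (hj : 1 ≤ j) :
    padicValRat 2 ((2 : ℚ) ^ (2 * j) * ((2 * N + 12 * j + 2).factorial : ℚ) *
      ((2 * N + 6 * j).factorial : ℚ) / (((2 * N + 8 * j + 2).factorial : ℚ) *
        ((2 * N + 8 * j - 2).factorial : ℚ) * ((2 * N + 12 * j : ℕ) : ℚ))) =
      3 * j + padicValNat 2 (N + (6 * j + 1)).factorial + padicValNat 2 (N + 3 * j).factorial
        - padicValNat 2 (N + (4 * j + 1)).factorial - padicValNat 2 (N + (4 * j - 1)).factorial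
        - padicValNat 2 (N + 6 * j) := by
  -- All factorials are of even numbers, so `v₂((2n)!) = n + v₂(n!)` applies. The linear terms
  -- contribute `j + 1`, the power of two `2j`, and the denominator `2(N + 6j)` a further `-1`, for
  -- a total of `3j`.
  rw [show 2 * N + 12 * j + 2 = 2 * (N + (6 * j + 1)) by ring,
    show 2 * N + 6 * j = 2 * (N + 3 * j) by ring,
    show 2 * N + 8 * j + 2 = 2 * (N + (4 * j + 1)) by ring,
    show 2 * N + 8 * j - 2 = 2 * (N + (4 * j - 1)) by lia,
    show 2 * N + 12 * j = 2 * (N + 6 * j) by ring]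
  have hf (n : ℕ) : (n.factorial : ℚ) ≠ 0 := Nat.cast_ne_zero.mpr n.factorial_ne_zero
  have h0 : ((2 * (N + 6 * j) : ℕ) : ℚ) ≠ 0 := Nat.cast_ne_zero.mpr (by lia)
  have h2 : ((2 : ℚ) ^ (2 * j)) ≠ 0 := pow_ne_zero _ two_ne_zero
  rw [padicValRat.div (mul_ne_zero (mul_ne_zero h2 (hf _)) (hf _))
      (mul_ne_zero (mul_ne_zero (hf _) (hf _)) h0),
    padicValRat.mul (mul_ne_zero h2 (hf _)) (hf _), padicValRat.mul h2 (hf _),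
    padicValRat.mul (mul_ne_zero (hf _) (hf _)) h0, padicValRat.mul (hf _) (hf _),
    padicValRat.of_nat, padicValRat.of_nat, padicValRat.of_nat, padicValRat.of_nat,
    padicValRat.of_nat, padicValNat.mul two_ne_zero (by lia),
    padicValNat_factorial_two_mul, padicValNat_factorial_two_mul, padicValNat_factorial_two_mul,
    padicValNat_factorial_two_mul, padicValRat.pow,
    show padicValRat 2 (2 : ℚ) = 1 from padicValRat.self (by norm_num), padicValNat_self]
  push_cast [show 1 ≤ 4 * j by lia]
  ring

lemma bcProduct_ne_zero (n i : ℕ) : bcProduct n i ≠ 0 := by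
  refine Finset.prod_ne_zero_iff.mpr fun j hj ↦ ?_
  have : 1 ≤ j := (Finset.mem_Icc.mp hj).1
  have h12 : n + 12 * j ≠ 0 := by lia
  positivity

lemma bcProduct_succ (n i : ℕ) :
    bcProduct n (i + 1) = bcProduct n i *
      ((2 : ℚ) ^ (2 * (i + 1)) * ((n + 12 * (i + 1) + 2).factorial : ℚ) *
        ((n + 6 * (i + 1)).factorial : ℚ) / (((n + 8 * (i + 1) + 2).factorial : ℚ) *
          ((n + 8 * (i + 1) - 2).factorial : ℚ) * ((n + 12 * (i + 1) : ℕ) : ℚ))) := by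
  rw [bcProduct, Finset.prod_Icc_succ_top (by lia), bcProduct]

/-- Both sides vanish at `i = 0` and have the same increments. The bound `M` is left free so that
indices `i` and `i + 1` can be summed over a common range. -/
lemma sum_mult_eq (N i : ℕ) {M : ℕ} (hM : 6 * i + 2 ≤ M) :
    ∑ m ∈ Finset.range M, mult i (2 * m) * (3 + padicValNat 2 (m + N) : ℤ) =
      padicValRat 2 (bcProduct (2 * N) i) := by
  induction i with
  | zero => simp [mult_zero, bcProduct]
  | succ i ih =>
    set j := i + 1 with hj
    have hsub (s : Finset ℕ) (hs : s ⊆ Finset.range M) :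
        ∑ m ∈ Finset.range M, (if m ∈ s then (1 : ℤ) else 0) * (3 + padicValNat 2 (m + N) : ℤ) =
          ∑ m ∈ s, (3 + padicValNat 2 (m + N) : ℤ) := by
      simp only [ite_mul, one_mul, zero_mul]
      rw [Finset.sum_ite_mem, Finset.inter_eq_right.mpr hs]
    have hstep : ∑ m ∈ Finset.range M, mult j (2 * m) * (3 + padicValNat 2 (m + N) : ℤ) =
        ∑ m ∈ Finset.range M, mult i (2 * m) * (3 + padicValNat 2 (m + N) : ℤ) +
        (∑ m ∈ (Finset.Ioc (4 * j + 1) (6 * j + 1)).erase (6 * j),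
          (3 + padicValNat 2 (m + N) : ℤ) -
        ∑ m ∈ Finset.Ioc (3 * j) (4 * j - 1), (3 + padicValNat 2 (m + N) : ℤ)) := by
      rw [← hsub _ fun m hm ↦ by simp at hm ⊢; lia, ← hsub _ fun m hm ↦ by simp at hm ⊢; lia,
        ← Finset.sum_sub_distrib, ← Finset.sum_add_distrib]
      refine Finset.sum_congr rfl fun m _ ↦ ?_
      rw [← sub_mul, ← mult_sub j m (by lia), show j - 1 = i by lia]
      ring
    rw [hstep, ih (by lia)]
    have hprod : padicValRat 2 (bcProduct (2 * N) j) = padicValRat 2 (bcProduct (2 * N) i) +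
        (3 * j + padicValNat 2 (N + (6 * j + 1)).factorial + padicValNat 2 (N + 3 * j).factorial
        - padicValNat 2 (N + (4 * j + 1)).factorial - padicValNat 2 (N + (4 * j - 1)).factorial
        - padicValNat 2 (N + 6 * j)) := by
      have hne := bcProduct_ne_zero (2 * N) j
      rw [hj, bcProduct_succ] at hne
      rw [hj, bcProduct_succ, padicValRat.mul (left_ne_zero_of_mul hne) (right_ne_zero_of_mul hne),
        padicValRat_bcFactor N (i + 1) (by lia)]
    have h6 := Finset.sum_erase_eq_sub (f := fun m ↦ (3 + padicValNat 2 (m + N) : ℤ))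
      (show 6 * j ∈ Finset.Ioc (4 * j + 1) (6 * j + 1) by simp; lia)
    rw [hprod, h6, padicValNat_factorial_eq_add_sum N (show 4 * j + 1 ≤ 6 * j + 1 by lia),
      padicValNat_factorial_eq_add_sum N (show 3 * j ≤ 4 * j - 1 by lia)]
    -- The constant `3` is counted `(2j - 1) - (j - 1) = j` times, matching the `3j` of
    -- `padicValRat_bcFactor`.
    simp only [Finset.sum_add_distrib, Finset.sum_const, Nat.card_Ioc, nsmul_eq_mul]
    rw [show 6 * j + 1 - (4 * j + 1) = 2 * j by lia, show 4 * j - 1 - 3 * j = j - 1 by lia,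
      add_comm (6 * j) N]
    push_cast [show 1 ≤ j by lia]
    ring

end Ghost
end

/-! ### Comparison of the Newton polygons -/

noncomputable section
namespace Ghost

lemma coeff_zero_ghostAt (γ : ℤ_[2]ˣ) (k : ℤ) : PowerSeries.coeff 0 (ghostAt γ k) = 1 := by
  rw [ghostAt, PowerSeries.coeff_map, ghostSeries, map_add, PowerSeries.coeff_mk]
  simp

lemma coeff_ghostAt (γ : ℤ_[2]ˣ) (k : ℤ) {i : ℕ} (hi : i ≠ 0) :
    PowerSeries.coeff i (ghostAt γ k) = ((ghostCoeff γ i).eval (weightCoord γ k) : ℤ_[2]) := by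
  simp [ghostAt, ghostSeries, PowerSeries.coeff_one, hi]

lemma coeff_zero_bcSeries (n : ℕ) : PowerSeries.coeff 0 (bcSeries n) = 1 := by
  simp [bcSeries]

lemma coeff_bcSeries (n : ℕ) {i : ℕ} (hi : i ≠ 0) :
    PowerSeries.coeff i (bcSeries n) = (bcProduct n i : ℚ) := by
  simp [bcSeries, PowerSeries.coeff_one, hi]

/-- Power series whose coefficients have the same supports and valuations have the same points. -/
lemma newtonPoints_congr {P Q : PowerSeries ℚ_[2]}
    (h0 : ∀ i, PowerSeries.coeff i P ≠ 0 ↔ PowerSeries.coeff i Q ≠ 0)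
    (hv : ∀ i, (PowerSeries.coeff i P).valuation = (PowerSeries.coeff i Q).valuation) :
    newtonPoints P = newtonPoints Q := by
  simp only [newtonPoints, h0, hv]

end Ghost
end

/-- The `2`-adic ghost series of tame level one at an even weight `k ≤ 0`: each coefficient is a
finite product, its value at `w_k` is non-zero with the stated valuation, and the Newton polygon of
`G_k` has the slopes predicted by Buzzard and Calegari. -/
theorem theorem3p3 (γ : ℤ_[2]ˣ) (hγ : Ghost.IsTopGenerator γ) :
    (∀ i : ℕ, {k : ℤ | Even k ∧ Ghost.mult i k ≠ 0}.Finite) ∧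
    ∀ k : ℤ, Even k → k ≤ 0 →
      (∀ i : ℕ, 1 ≤ i →
        (Ghost.ghostCoeff γ i).eval (Ghost.weightCoord γ k) ≠ 0 ∧
        (((Ghost.ghostCoeff γ i).eval (Ghost.weightCoord γ k) : ℤ_[2]) : ℚ_[2]).valuation =
          padicValRat 2 (Ghost.bcProduct (-k).toNat i)) ∧
      Ghost.newtonPolygon (Ghost.ghostAt γ k) =
        Ghost.newtonPolygon (Ghost.bcSeries (-k).toNat) ∧
      ∀ n : ℕ, 1 ≤ n →
        Ghost.newtonSlope (Ghost.ghostAt γ k) n =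
          Ghost.newtonSlope (Ghost.bcSeries (-k).toNat) n := by
  refine ⟨Ghost.finite_setOf_mult_ne_zero, fun k hk hk0 ↦ ?_⟩
  obtain ⟨N, rfl⟩ : ∃ N : ℕ, k = -(2 * N : ℕ) := by
    obtain ⟨r, rfl⟩ := hk
    exact ⟨(-r).toNat, by lia⟩
  have hn : (-(-(2 * N : ℕ) : ℤ)).toNat = 2 * N := by lia
  rw [hn]
  -- The range `6i + 2` is exactly the one used to evaluate `g_i`, so the two valuation formulas
  -- combine directly.
  have hval (i : ℕ) := Ghost.sum_mult_eq N i le_rfl ▸ Ghost.valuation_eval_ghostCoeff hγ N i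
  have hpts : Ghost.newtonPoints (Ghost.ghostAt γ (-(2 * N : ℕ))) =
      Ghost.newtonPoints (Ghost.bcSeries (2 * N)) := by
    refine Ghost.newtonPoints_congr (fun i ↦ ?_) fun i ↦ ?_ <;>
    rcases eq_or_ne i 0 with rfl | hi
    · rw [Ghost.coeff_zero_ghostAt, Ghost.coeff_zero_bcSeries]
    · rw [Ghost.coeff_ghostAt _ _ hi, Ghost.coeff_bcSeries _ hi, PadicInt.coe_ne_zero]
      exact iff_of_true (hval i).1 (Rat.cast_ne_zero.mpr (Ghost.bcProduct_ne_zero _ i))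
    · rw [Ghost.coeff_zero_ghostAt, Ghost.coeff_zero_bcSeries]
    · rw [Ghost.coeff_ghostAt _ _ hi, Ghost.coeff_bcSeries _ hi, Padic.valuation_ratCast,
        (hval i).2]
  have hpoly : Ghost.newtonPolygon (Ghost.ghostAt γ (-(2 * N : ℕ))) =
      Ghost.newtonPolygon (Ghost.bcSeries (2 * N)) := by
    funext x
    rw [Ghost.newtonPolygon, Ghost.newtonPolygon, hpts]
  refine ⟨fun i _ ↦ hval i, hpoly, fun n _ ↦ ?_⟩
  rw [Ghost.newtonSlope, Ghost.newtonSlope, hpoly]
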